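/- **Alternating machines.** An alternating Turing machine is a tuple $M=\langle Q,E,q_0,q_A,q_R,\Sigma,\Gamma,B,\delta\rangle$ with finite $Q$ and $\Gamma$, existential states $E\subseteq Q$ (states in $Q\setminus E$ are universal), $q_0\in E$, $q_A,q_R\in Q$, $\Sigma\subseteq\Gamma$, blank $B\in\Gamma$ and $\delta\subseteq Q\times\Gamma\times\Gamma\times\{L,N,R\}\times Q$, such that for every non-final state $q\notin\{q_A,q_R\}$ and every $a\in\Gamma$ there are exactly two transitions $\langle q,a,\_,\_,\_\rangle\in\delta$, and every transition leads from $E$ to $Q\setminus E$ or from $Q\setminus E$ to $E$. A transition $\langle q,a,b,m,q'\rangle$ is used in state $q$ scanning $a$; it writes $b$, moves the head according to $m$ and changes the state to $q'$. The machine halts in $q_A$ and in $q_R$. In the initial configuration for $w\in\Sigma^*$ the word $w$ stands in cells $0,\dots,|w|-1$, all other cells are blank, and the head scans cell $0$ in state $q_0$. Accepting configurations (state $q_A$) lead to acceptance; a non-final existential (universal) configuration leads to acceptance if some (every) successor does; $M$ accepts $w$ if the initial configuration leads to acceptance. $M$ works in exponential space on $w$ if, in all computations on $w$, the head visits only the $2^{|w|}-1$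 cells $0,\dots,2^{|w|}-2$ (for $w$ empty this is impossible). The size of $M$ is $|Q|+|\Gamma|+|\delta|$. **Tiling games.** A tiling game is a tuple $\langle C,T_0,T_1,n,\langle t_0,\dots,t_n\rangle,\Box,L\rangle$ with $C$ a finite set of colours, $T_0,T_1\subseteq C^4$ sets of tiles, $n\in\mathbb N$, $t_0,\dots,t_n\in C^4$, $\Box\in C$ (white) and $L\subseteq T_0\cup T_1$. A tile $\langle a,b,c,d\rangle$ is a square with upper corners coloured $a,b$ and lower corners coloured $c,d$ (from left to right). Adjacent tiles must match: to the right of $\langle a,b,c,d\rangle$ only tiles $\langle b,e,d,f\rangle$ may stand, and below it only tiles $\langle c,d,e,f\rangle$. Rows consist of $2^n$ tiles; the first row is $t_0,\dots,t_n$ padded with tiles $\langle\Box,\Box,\Box,\Box\rangle$. A finite tiling that begins with this first row is correct if adjacent tiles match and the upper, left and right edges are white; it is a correctly tiled corridor if moreover its last row consists of tiles in $L$ and its lower edge is white. Starting from the first row, Prover and Spoiler alternately, Prover first, choose one of $T_0,T_1$ and add below one row built from tiles of the chosen set so that the tiling remains correct. Prover wins if after finitely many moves there is a correctly tiled corridor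 (the game is then over); otherwise Spoiler wins. The game is well-formed if for every tiling constructed in a play that is not yet a correctly tiled corridor, exactly one new row can be correctly constructed from $T_0$ and exactly one from $T_1$. The size of the game is $|C|+|T_0|+|T_1|+n+(n+1)+|L|$. **Theorem.** There is a polynomial $P$ such that for every alternating Turing machine $M$ there are $C,T_0,T_1,\Box,L$ as above, depending on $M$ only, and maps $f,g:\Gamma\to C$, such that the following holds for every input word $w=w_1\cdots w_n\in\Sigma^*$ on which $M$ works in exponential space. Let $c_0=c_{n+1}=\Box$, $c_1=f(w_1)$, $c_i=g(w_i)$ for $2\le i\le n$, and $t_i=\langle\Box,\Box,c_i,c_{i+1}\rangle$ for $0\le i\le n$. Then the tiling game $\langle C,T_0,T_1,n,\langle t_0,\dots,t_n\rangle,\Box,L\rangle$ is well-formed, its size is at most $P(\mathrm{size}(M)+|w|)$, and Prover has a winning strategy in it if and only if $M$ accepts $w$. -/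

import Mathlib

/-! ### Alternating Turing machines -/

/-- Head movements: left, none, right. -/
inductive HeadMove where
  | L | N | R

/-- The displacement of the head. -/
def HeadMove.shift : HeadMove → ℤ
  | .L => -1
  | .N => 0
  | .R => 1

/-- A (normalised) alternating Turing machine with state set `Q` and tape alphabet `Γ`:
every non-final state has exactly two transitions for each scanned symbol, and transitions
alternate between existential states (those in `E`) and universal states (the others). -/
structure ATM (Q Γ : Type) where
  E : Finset Q
  start : Q
  acc : Q
  rej : Q
  inputAlphabet : Finset Γ
  blank : Γ
  /-- `(q, a, b, m, q') ∈ δ`: in state `q` scanning `a`, write `b`, move by `m`, go to `q'`. -/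
  δ : Finset (Q × Γ × Γ × HeadMove × Q)
  start_mem : start ∈ E
  two_transitions : ∀ q a, q ≠ acc → q ≠ rej →
    {t : Γ × HeadMove × Q | (q, a, t) ∈ δ}.ncard = 2
  alternating : ∀ q a b m q', (q, a, b, m, q') ∈ δ → (q ∈ E ↔ q' ∉ E)

/-- A configuration: the state, the position of the head and the content of the tape. -/
structure ATM.Config (Q Γ : Type) where
  state : Q
  head : ℤ
  tape : ℤ → Γ

namespace ATM

variable {Q Γ : Type} (M : ATM Q Γ)

/-- The size of the machine. A machine is written down with `O(size * log size)` symbols. -/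
def size [Fintype Q] [Fintype Γ] : ℕ :=
  Fintype.card Q + Fintype.card Γ + M.δ.card

/-- The initial configuration: `w` is in the cells `0, …, |w| - 1`, all other cells are blank,
and the head scans the cell `0`. -/
def initial (w : List Γ) : Config Q Γ where
  state := M.start
  head := 0
  tape := fun i => if 0 ≤ i then w.getD i.toNat M.blank else M.blank

/-- Final states are the accepting and the rejecting one; the machine halts there. -/
def IsFinal (q : Q) : Prop := q = M.acc ∨ q = M.rej

/-- `M.Step c c'`: `c'` is a successor configuration of `c`. -/
def Step (c c' : Config Q Γ) : Prop :=
  ¬ M.IsFinal c.state ∧ ∃ b m q', (c.state, c.tape c.head, b, m, q') ∈ M.δ ∧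
    c' = ⟨q', c.head + m.shift, Function.update c.tape c.head b⟩

/-- In its computations on `w`, the machine only ever visits the cells `0, …, s - 1`. -/
def UsesOnlyCells (w : List Γ) (s : ℕ) : Prop :=
  ∀ c, Relation.ReflTransGen M.Step (M.initial w) c → 0 ≤ c.head ∧ c.head < (s : ℤ)

/-- The configurations that lead to acceptance. -/
inductive LeadsToAcceptance : Config Q Γ → Prop
  | accepting (c : Config Q Γ) : c.state = M.acc → LeadsToAcceptance c
  | existential (c c' : Config Q Γ) : ¬ M.IsFinal c.state → c.state ∈ M.E →
      M.Step c c' → LeadsToAcceptance c' → LeadsToAcceptance c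
  | universal (c : Config Q Γ) : ¬ M.IsFinal c.state → c.state ∉ M.E →
      (∀ c', M.Step c c' → LeadsToAcceptance c') → LeadsToAcceptance c

/-- The machine accepts the word `w`. -/
def Accepts (w : List Γ) : Prop := M.LeadsToAcceptance (M.initial w)

end ATM

/-! ### Tiling games -/

/-- A tile `(a, b, c, d)`: upper left, upper right, lower left and lower right colour. -/
abbrev Tile (C : Type) : Type := C × C × C × C

namespace Tile

variable {C : Type}

def upLeft (t : Tile C) : C := t.1
def upRight (t : Tile C) : C := t.2.1
def lowLeft (t : Tile C) : C := t.2.2.1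
def lowRight (t : Tile C) : C := t.2.2.2

/-- `t` may stand immediately to the right of `s`. -/
def HAdj (s t : Tile C) : Prop := s.upRight = t.upLeft ∧ s.lowRight = t.lowLeft

/-- `t` may stand immediately below `s`. -/
def VAdj (s t : Tile C) : Prop := s.lowLeft = t.upLeft ∧ s.lowRight = t.upRight

end Tile

/-- The part of a tiling game that does not concern the first row: the two sets of tiles
(`T false` is `T₀` and `T true` is `T₁`), the colour white, and the tiles allowed in the
last row. -/
structure TileSystem (C : Type) where
  T : Bool → Finset (Tile C)
  white : C
  L : Finset (Tile C)
  L_subset : ∀ t ∈ L, t ∈ T false ∨ t ∈ T true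

/-- A tiling game `(C, T₀, T₁, n, (t₀, …, tₙ), □, L)`. -/
structure TilingGame (C : Type) extends TileSystem C where
  n : ℕ
  init : Fin (n + 1) → Tile C

namespace TilingGame

variable {C : Type} (G : TilingGame C)

/-- The size of the game. A game is written down with `O(size * log size)` symbols; the number
`n` is counted in unary, since `n + 1` initial tiles are listed. -/
def size [Fintype C] : ℕ :=
  Fintype.card C + (G.T false).card + (G.T true).card + G.n + (G.n + 1) + G.L.card

/-- Rows consist of `2 ^ n` tiles. -/
abbrev Row : Type := Fin (2 ^ G.n) → Tile C

/-- The first row: the initial tiles, padded out with white tiles. -/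
def firstRow : G.Row := fun j =>
  if h : j.val < G.n + 1 then G.init ⟨j.val, h⟩ else (G.white, G.white, G.white, G.white)

/-- Horizontally adjacent tiles match, and the left and the right edge of the row are white. -/
def RowCorrect (r : G.Row) : Prop :=
  (∀ i j : Fin (2 ^ G.n), j.val = i.val + 1 → (r i).HAdj (r j)) ∧
  (∀ j : Fin (2 ^ G.n), j.val = 0 → (r j).upLeft = G.white ∧ (r j).lowLeft = G.white) ∧
  (∀ j : Fin (2 ^ G.n), j.val + 1 = 2 ^ G.n →
    (r j).upRight = G.white ∧ (r j).lowRight = G.white)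

/-- A correct, not necessarily complete tiling, as the list of its rows from top to bottom:
adjacent tiles match, the first row is as prescribed, and the upper, left and right edges
are white. -/
def TilingCorrect (R : List G.Row) : Prop :=
  R.head? = some G.firstRow ∧
  (∀ j, (G.firstRow j).upLeft = G.white ∧ (G.firstRow j).upRight = G.white) ∧
  (∀ r ∈ R, G.RowCorrect r) ∧
  R.IsChain (fun r s => ∀ j, (r j).VAdj (s j))

/-- A correctly tiled corridor: in addition, the last row consists of tiles in `L` and the lower
edge is white. -/
def IsCorridor (R : List G.Row) : Prop :=
  G.TilingCorrect R ∧ ∀ r, R.getLast? = some r →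
    ∀ j, r j ∈ G.L ∧ (r j).lowLeft = G.white ∧ (r j).lowRight = G.white

/-- After the rows `R`, the row `r` can be correctly constructed from tiles in `T b`. -/
def Move (R : List G.Row) (b : Bool) (r : G.Row) : Prop :=
  (∀ j, r j ∈ G.T b) ∧ G.TilingCorrect (R ++ [r])

/-- One move of the game. The game is over as soon as there is a correctly tiled corridor. -/
def Step (R R' : List G.Row) : Prop :=
  ¬ G.IsCorridor R ∧ ∃ b r, G.Move R b r ∧ R' = R ++ [r]

/-- The game is well-formed: at every non-complete tiling that is constructed in a play, exactly
one new row can be correctly constructed from tiles in `T₀` and exactly one from tiles in `T₁`. -/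
def WellFormed : Prop :=
  ∀ R, Relation.ReflTransGen G.Step [G.firstRow] R → ¬ G.IsCorridor R →
    ∀ b, ∃! r, G.Move R b r

/-- The players alternate and Prover begins; at the beginning there is one row. -/
def ProverTurn (R : List G.Row) : Prop := Odd R.length

/-- A strategy of Prover tells him which of the two sets to choose and which row to build. -/
abbrev Strategy : Type := List G.Row → Bool × G.Row

/-- One move of a play in which Prover follows the strategy `σ`. -/
def StepFollowing (σ : G.Strategy) (R R' : List G.Row) : Prop :=
  G.Step R R' ∧
    (G.ProverTurn R → G.Move R (σ R).1 (σ R).2 ∧ R' = R ++ [(σ R).2])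

/-- The strategy `σ` is winning for Prover: a play in which he follows `σ` never gets stuck before
there is a correctly tiled corridor, and never lasts forever. -/
def IsWinning (σ : G.Strategy) : Prop :=
  (∀ R, Relation.ReflTransGen (G.StepFollowing σ) [G.firstRow] R →
    ¬ G.IsCorridor R → ∃ R', G.StepFollowing σ R R') ∧
  ¬ ∃ p : ℕ → List G.Row, p 0 = [G.firstRow] ∧ ∀ i, G.StepFollowing σ (p i) (p (i + 1))

/-- Prover has a winning strategy. -/
def ProverWins : Prop := ∃ σ : G.Strategy, G.IsWinning σ

end TilingGame

/-- The tiling game with the tile system `S` in which `n` is the length of the word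
`u = c₁ … cₙ` of colours and the initial tiles are `tᵢ = (□, □, cᵢ, cᵢ₊₁)` for `i = 0, …, n`,
where `c₀ = cₙ₊₁ = □`; so the lower edge of the initial tiles spells `u`. -/
def TileSystem.game {C : Type} (S : TileSystem C) (u : List C) : TilingGame C where
  toTileSystem := S
  n := u.length
  init := fun i =>
    (S.white, S.white, (S.white :: u).getD i.val S.white, u.getD i.val S.white)

/-- The word `f(w₁) g(w₂) … g(wₙ)`, for a word `w₁ w₂ … wₙ`. -/
def encodeWord {Γ C : Type} (f g : Γ → C) : List Γ → List C
  | [] => []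
  | a :: v => f a :: v.map g

/-! The lower edge of each row spells a configuration: corner `i + 1` carries cell `i`, and the
corners `0` and `2 ^ n` stay white, which leaves exactly `2 ^ n - 1` cells. The tiles of `T b`
simulate the `b`-th transition, so choosing a tile set is choosing a transition, and alternation of
states matches alternation of players.

The difficulty is locality. The next colour of a cell depends on the cell and both neighbours, but a
tile sees only two adjacent cells. Each lower corner is shared by two tiles, which together see all
three cells. A tile may guess that the head arrives from the side it does not see. Two simultaneous
wrong guesses are excluded because a colour records the direction of arrival
(`Encodes.rightOK_and_leftOK_iff`). Hence the next row is forced (`Encodes.step_forced`).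

Below an accepting configuration only an erasing, all-white row fits (`Encodes.erase_forced`), and
it completes the corridor. A rejecting configuration is copied forever, so Spoiler wins. Thus plays
follow computations (`Represents.append`). Acceptance yields a winning rank by induction;
conversely, the plays that follow a winning strategy are well-founded and yield acceptance by
induction. -/

namespace TilingGame

/-! ### Rows and their lower edges -/

variable {C : Type} (G : TilingGame C)

/-- The colours of the corners on the lower side of a row, from left to right. -/
def lowerEdge (r : G.Row) (i : ℕ) : C :=
  if h : i < 2 ^ G.n then (r ⟨i, h⟩).lowLeft else G.white

variable {G}

theorem lowerEdge_coe (r : G.Row) (j : Fin (2 ^ G.n)) : G.lowerEdge r j = (r j).lowLeft := by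
  simp [lowerEdge]

theorem lowerEdge_last (r : G.Row) : G.lowerEdge r (2 ^ G.n) = G.white := by
  simp [lowerEdge]

theorem RowCorrect.lowerEdge_zero {r : G.Row} (hr : G.RowCorrect r) :
    G.lowerEdge r 0 = G.white := by
  have h : 0 < 2 ^ G.n := by positivity
  simpa [lowerEdge, h] using (hr.2.1 ⟨0, h⟩ rfl).2

/-- For the last tile, `j + 1` is the index at which `lowerEdge` takes its default value; this is
the actual corner because the right edge is white. -/
theorem RowCorrect.lowerEdge_succ {r : G.Row} (hr : G.RowCorrect r) (j : Fin (2 ^ G.n)) :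
    G.lowerEdge r (j + 1) = (r j).lowRight := by
  by_cases h : (j : ℕ) + 1 < 2 ^ G.n
  · simpa [lowerEdge, h] using (hr.1 j ⟨j + 1, h⟩ rfl).2.symm
  · have h' : (j : ℕ) + 1 = 2 ^ G.n := by omega
    rw [(hr.2.2 j h').2, h', lowerEdge_last]

theorem TilingCorrect.rowCorrect_getLast {R : List G.Row} (hR : G.TilingCorrect R) {r : G.Row}
    (hr : R.getLast? = some r) : G.RowCorrect r :=
  hR.2.2.1 r (List.mem_of_getLast? hr)

/-- If the tile set `T b` leaves the single possibility `e` for the lower side of the next row, then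
the moves with `T b` are described by `e`. -/
theorem move_iff_of_forced {R : List G.Row} (hR : G.TilingCorrect R) {r₀ : G.Row}
    (hr₀ : R.getLast? = some r₀) {b : Bool} {e : ℕ → C} (h0 : e 0 = G.white)
    (hN : e (2 ^ G.n) = G.white)
    (he : ∀ v : ℕ → C, v 0 = G.white → v (2 ^ G.n) = G.white →
      ((∀ j < 2 ^ G.n, (G.lowerEdge r₀ j, G.lowerEdge r₀ (j + 1), v j, v (j + 1)) ∈ G.T b) ↔
        ∀ i ≤ 2 ^ G.n, v i = e i)) (r : G.Row) :
    G.Move R b r ↔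
      ∀ j : Fin (2 ^ G.n), r j = (G.lowerEdge r₀ j, G.lowerEdge r₀ (j + 1), e j, e (j + 1)) := by
  have hr₀c := hR.rowCorrect_getLast hr₀
  constructor
  · rintro ⟨hT, hc⟩
    have hrc : G.RowCorrect r := hc.2.2.1 r (by simp)
    have hch := (List.isChain_append.1 hc.2.2.2).2.2 r₀ (by simp [hr₀]) r (by simp)
    have hform : ∀ j : Fin (2 ^ G.n), r j = (G.lowerEdge r₀ j, G.lowerEdge r₀ (j + 1),
        G.lowerEdge r j, G.lowerEdge r (j + 1)) := by
      intro j
      rw [lowerEdge_coe, lowerEdge_coe, hr₀c.lowerEdge_succ, hrc.lowerEdge_succ, (hch j).1,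
        (hch j).2]
      rfl
    have key := (he (G.lowerEdge r) hrc.lowerEdge_zero (lowerEdge_last r)).1 (fun j hj => by
      have := hform ⟨j, hj⟩
      rw [← this]
      exact hT _)
    intro j
    rw [hform j, key _ j.2.le, key _ j.2]
  · intro hform
    have hT := (he e h0 hN).2 fun _ _ => rfl
    refine ⟨fun j => ?_, ?_, hR.2.1, ?_, ?_⟩
    · rw [hform]
      exact hT j j.2
    · obtain ⟨a, l, rfl⟩ : ∃ a l, R = a :: l := by
        cases R with
        | nil => simp at hr₀
        | cons a l => exact ⟨a, l, rfl⟩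
      simpa using hR.1
    · intro s hs
      rcases List.mem_append.1 hs with hs | hs
      · exact hR.2.2.1 s hs
      obtain rfl : s = r := by simpa using hs
      refine ⟨fun i j hij => ?_, fun j hj => ?_, fun j hj => ?_⟩
      · rw [hform i, hform j]
        simp [Tile.HAdj, Tile.upRight, Tile.upLeft, Tile.lowLeft, Tile.lowRight, hij]
      · rw [hform j]
        simp [Tile.upLeft, Tile.lowLeft, hj, h0, hr₀c.lowerEdge_zero]
      · rw [hform j]
        simp [Tile.upRight, Tile.lowRight, hj, hN, lowerEdge_last]
    · refine List.isChain_append.2 ⟨hR.2.2.2, by simp, ?_⟩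
      intro x hx y hy j
      obtain rfl : r₀ = x := by simpa [hr₀] using hx
      obtain rfl : r = y := by simpa using hy
      rw [hform j]
      exact ⟨(lowerEdge_coe r₀ j).symm, (hr₀c.lowerEdge_succ j).symm⟩

theorem lowerEdge_of_forall {r : G.Row} {x y : ℕ → C} {e : ℕ → C} (hN : e (2 ^ G.n) = G.white)
    (h : ∀ j : Fin (2 ^ G.n), r j = (x j, y j, e j, e (j + 1))) {i : ℕ} (hi : i ≤ 2 ^ G.n) :
    G.lowerEdge r i = e i := by
  rcases hi.lt_or_eq with hi | rfl
  · simp [lowerEdge, hi, h ⟨i, hi⟩, Tile.lowLeft]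
  · rw [lowerEdge_last, hN]

/-! ### Winning strategies and ranks -/

variable (G)

/-- Prover can enforce a correctly tiled corridor within `k` moves. -/
def WinsWithin : ℕ → List G.Row → Prop
  | 0, R => G.IsCorridor R
  | k + 1, R => WinsWithin k R ∨
      (G.ProverTurn R ∧ ∃ p : Bool × G.Row, G.Move R p.1 p.2 ∧ WinsWithin k (R ++ [p.2])) ∨
      (¬ G.ProverTurn R ∧ (∃ b r, G.Move R b r) ∧
        ∀ b r, G.Move R b r → WinsWithin k (R ++ [r]))

variable {G}

theorem WinsWithin.mono {k l : ℕ} (hkl : k ≤ l) {R : List G.Row} (h : G.WinsWithin k R) :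
    G.WinsWithin l R := by
  induction hkl with
  | refl => exact h
  | step _ ih => exact Or.inl ih

-- Merely staying in positions won within some bound could postpone the win forever. The strategy
-- therefore lowers the least bound `best R` with each of Prover's moves; Spoiler's moves lower it
-- anyway.
open Classical in
theorem proverWins_of_winsWithin {k : ℕ} (hk : G.WinsWithin k [G.firstRow]) : G.ProverWins := by
  let best : List G.Row → ℕ := fun R => sInf {k | G.WinsWithin k R}
  let good : List G.Row → Bool × G.Row → Prop := fun R p =>
    G.Move R p.1 p.2 ∧ G.WinsWithin (best R - 1) (R ++ [p.2])
  let σ : G.Strategy := fun R =>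
    if h : ∃ p, good R p then h.choose else (false, G.firstRow)
  have hbest : ∀ {k R}, G.WinsWithin k R → ¬ G.IsCorridor R → ∃ m, m + 1 ≤ k ∧ best R = m + 1 ∧
      ((G.ProverTurn R ∧ good R (σ R)) ∨
      (¬ G.ProverTurn R ∧ (∃ b r, G.Move R b r) ∧
        ∀ b r, G.Move R b r → G.WinsWithin m (R ++ [r]))) := by
    intro k R hk hR
    have hle : best R ≤ k := Nat.sInf_le hk
    have hmem : G.WinsWithin (best R) R := Nat.sInf_mem (s := {k | G.WinsWithin k R}) ⟨k, hk⟩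
    rcases hm : best R with _ | m
    · rw [hm] at hmem
      exact absurd hmem hR
    · refine ⟨m, hm ▸ hle, rfl, ?_⟩
      rw [hm] at hmem
      rcases hmem with h | ⟨ht, p, hp, hw⟩ | h
      · have : best R ≤ m := Nat.sInf_le h
        omega
      · have hex : ∃ p, good R p := ⟨p, hp, by rw [hm]; exact hw⟩
        refine Or.inl ⟨ht, ?_⟩
        simp only [σ, dif_pos hex]
        exact hex.choose_spec
      · exact Or.inr h
  have hstep : ∀ {k R R'}, G.WinsWithin (k + 1) R → G.StepFollowing σ R R' →
      G.WinsWithin k R' := by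
    rintro k R R' hk ⟨⟨hR, b, r, hmove, rfl⟩, hfol⟩
    obtain ⟨m, hmk, hm, ⟨ht, hg⟩ | ⟨ht, -, hall⟩⟩ := hbest hk hR
    · rw [(hfol ht).2]
      have := hg.2
      rw [hm] at this
      exact this.mono (by omega)
    · exact (hall b r hmove).mono (by omega)
  refine ⟨σ, fun R hR hcor => ?_, ?_⟩
  · obtain ⟨l, hl⟩ : ∃ l, G.WinsWithin l R := by
      induction hR with
      | refl => exact ⟨k, hk⟩
      | tail _ hs ih =>
        obtain ⟨l, hl⟩ := ih hs.1.1
        exact ⟨l, hstep (hl.mono l.le_succ) hs⟩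
    obtain ⟨m, -, -, ⟨ht, hg⟩ | ⟨ht, ⟨b, r, hmove⟩, -⟩⟩ := hbest hl hcor
    · exact ⟨_, ⟨hcor, _, _, hg.1, rfl⟩, fun _ => ⟨hg.1, rfl⟩⟩
    · exact ⟨_, ⟨hcor, b, r, hmove, rfl⟩, fun h => absurd h ht⟩
  · rintro ⟨p, hp0, hp⟩
    have : ∀ i ≤ k, G.WinsWithin (k - i) (p i) := by
      intro i
      induction i with
      | zero => intro _; rw [hp0]; exact hk
      | succ i ih =>
        intro hi
        refine hstep ?_ (hp i)
        have := ih (by omega)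
        rwa [show k - i = k - (i + 1) + 1 by omega] at this
    have h := this k le_rfl
    rw [Nat.sub_self] at h
    exact (hp k).1.1 h

/-- By dependent choice, an inaccessible position would start an infinite play. This turns the
absence of infinite plays into an induction principle. -/
theorem IsWinning.acc {σ : G.Strategy} (hσ : G.IsWinning σ) :
    Acc (fun R' R => G.StepFollowing σ R R') [G.firstRow] := by
  by_contra h
  have hex : ∀ R : {R // ¬ Acc (fun R' R => G.StepFollowing σ R R') R},
      ∃ R' : {R // ¬ Acc (fun R' R => G.StepFollowing σ R R') R}, G.StepFollowing σ R R' := by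
    rintro ⟨R, hR⟩
    by_contra hno
    refine hR ⟨_, fun R' hR' => ?_⟩
    by_contra hacc
    exact hno ⟨⟨R', hacc⟩, hR'⟩
  choose next hnext using hex
  exact hσ.2 ⟨fun i => (next^[i] ⟨_, h⟩).1, rfl, fun i => by
    simpa only [Function.iterate_succ_apply'] using hnext _⟩

theorem wellFormed_and_proverWins_of_isCorridor (h : G.IsCorridor [G.firstRow]) :
    G.WellFormed ∧ G.ProverWins := by
  refine ⟨fun R hR hcor => ?_, proverWins_of_winsWithin (k := 0) h⟩
  rcases Relation.ReflTransGen.cases_head hR with rfl | ⟨R', hs, -⟩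
  · exact absurd h hcor
  · exact absurd h hs.1

end TilingGame

/-! ### Colours and tiles of the simulation -/

/-- The colours of the simulating tiles: white, a tape symbol, or a tape symbol together with the
state of the machine and the direction in which the head moved to reach this cell. -/
inductive CellColour (Q Γ : Type)
  | white
  | sym (a : Γ)
  | head (q : Q) (a : Γ) (m : HeadMove)

namespace CellColour

variable {Q Γ : Type}

/-- An injective code for colours. -/
def code : CellColour Q Γ → Option (Γ × Option (Q × Fin 3))
  | white => none
  | sym a => some (a, none)
  | head q a .L => some (a, some (q, 0))
  | head q a .N => some (a, some (q, 1))
  | head q a .R => some (a, some (q, 2))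

theorem code_injective : Function.Injective (code : CellColour Q Γ → _) := by
  rintro (_ | a | ⟨q, a, _ | _ | _⟩) (_ | a' | ⟨q', a', _ | _ | _⟩) h <;> simp_all [code]

noncomputable instance [Fintype Q] [Fintype Γ] : Fintype (CellColour Q Γ) :=
  Fintype.ofInjective code code_injective

theorem card_le [Fintype Q] [Fintype Γ] :
    Fintype.card (CellColour Q Γ) ≤ 1 + Fintype.card Γ * (1 + 3 * Fintype.card Q) := by
  refine (Fintype.card_le_of_injective _ code_injective).trans ?_
  simp only [Fintype.card_option, Fintype.card_prod, Fintype.card_fin]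
  apply le_of_eq
  ring

variable (blank : Γ) (tr : Q → Γ → Γ × HeadMove × Q)

/-- The tape symbol of a cell; white cells count as blank. -/
def symbol : CellColour Q Γ → Γ
  | white => blank
  | sym a => a
  | head _ a _ => a

/-- `x.Sends tr m q`: the head leaves the cell `x` in the direction `m` and in the state `q`. -/
def Sends (x : CellColour Q Γ) (m : HeadMove) (q : Q) : Prop :=
  ∃ p a d, x = head p a d ∧ (tr p a).2 = (m, q)

/-- The next colour of a cell that the head does not enter from a neighbouring cell. -/
def next : CellColour Q Γ → CellColour Q Γ
  | white => sym blank
  | sym a => sym a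
  | head q a _ => match tr q a with
    | (b, .N, q') => head q' b .N
    | (b, _, _) => sym b

/-- `x'` may stand below `x` if `y` is to the right of `x`. -/
def LeftOK (x y x' : CellColour Q Γ) : Prop :=
  -- This keeps the left end white. The condition on `y` prevents white padding from staying white:
  -- each padding cell has a white right neighbour.
  (x = white ∧ y ≠ white ∧ x' = white) ∨
  (∃ q, y.Sends tr .L q ∧ x' = head q (x.symbol blank) .L) ∨
  ((¬ ∃ q, y.Sends tr .L q) ∧
    -- The second option is a guess: the head comes from the left neighbour of `x`, which this tile
    -- does not see.
    (x' = x.next blank tr ∨ ∃ q, x' = head q (x.symbol blank) .R))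

/-- `y'` may stand below `y` if `x` is to the left of `y`. -/
def RightOK (x y y' : CellColour Q Γ) : Prop :=
  (y = white ∧ y' = white) ∨
  (∃ q, x.Sends tr .R q ∧ y' = head q (y.symbol blank) .R) ∨
  ((¬ ∃ q, x.Sends tr .R q) ∧
    (y' = y.next blank tr ∨ ∃ q, y' = head q (y.symbol blank) .L))

/-- The cell is scanned in a state with the property `p`. -/
def Scanned (p : Q → Prop) (x : CellColour Q Γ) : Prop := ∃ q a m, x = head q a m ∧ p q

/-- The tiles that simulate a transition. -/
def IsStepTile (acc : Q) (t : Tile (CellColour Q Γ)) : Prop :=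
  ¬ t.upLeft.Scanned (· = acc) ∧ ¬ t.upRight.Scanned (· = acc) ∧
    LeftOK blank tr t.upLeft t.upRight t.lowLeft ∧ RightOK blank tr t.upLeft t.upRight t.lowRight

/-- The tiles of the last row. -/
def IsEraseTile (acc : Q) (t : Tile (CellColour Q Γ)) : Prop :=
  ¬ t.upLeft.Scanned (· ≠ acc) ∧ ¬ t.upRight.Scanned (· ≠ acc) ∧
    -- Without this condition, erasing tiles could be used below white padding next to step tiles.
    ¬ (t.upLeft = white ∧ t.upRight = white) ∧ t.lowLeft = white ∧ t.lowRight = white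

variable {blank tr}

theorem next_ne_white (x : CellColour Q Γ) : x.next blank tr ≠ white := by
  rcases x with _ | a | ⟨q, a, m⟩ <;> simp only [next, ne_eq, reduceCtorEq, not_false_eq_true]
  split <;> simp

/-- Together with `RightOK.white` this separates the two kinds of tiles: a step tile has a white
lower corner only below a white one, and on its left side only if the other upper corner is not
white. -/
theorem LeftOK.white {x y : CellColour Q Γ} (h : LeftOK blank tr x y white) :
    x = white ∧ y ≠ white := by
  rcases h with h | ⟨q, -, h⟩ | ⟨-, h | ⟨q, h⟩⟩
  · exact ⟨h.1, h.2.1⟩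
  · simp at h
  · exact absurd h.symm (next_ne_white x)
  · simp at h

theorem RightOK.white {x y : CellColour Q Γ} (h : RightOK blank tr x y white) : y = white := by
  rcases h with h | ⟨q, -, h⟩ | ⟨-, h | ⟨q, h⟩⟩
  · exact h.1
  · simp at h
  · exact absurd h.symm (next_ne_white y)
  · simp at h

/-! ### Encoded configurations and the forced next row -/

/-- The corners `u 0, …, u N` encode the configuration `c`: the ends are white, and the corner
`i + 1` stands for the cell `i`. Blank cells at the right end may be white. -/
structure Encodes (blank : Γ) (N : ℕ) (u : ℕ → CellColour Q Γ) (c : ATM.Config Q Γ) : Prop where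
  left : u 0 = white
  right : u N = white
  first : u 1 ≠ white
  cell : ∀ i : ℕ, 0 < i → i < N →
    (c.head = (i : ℤ) - 1 ∧ ∃ m, u i = head c.state (c.tape (i - 1)) m) ∨
    (c.head ≠ (i : ℤ) - 1 ∧ u i = sym (c.tape (i - 1))) ∨
    (c.head ≠ (i : ℤ) - 1 ∧ u i = white ∧ c.tape (i - 1) = blank ∧ u (i + 1) = white)

/-- The head of `c` scans one of the cells `0, …, N - 2`. -/
def InRange (N : ℕ) (c : ATM.Config Q Γ) : Prop := 0 ≤ c.head ∧ c.head < (N : ℤ) - 1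

/-- The successor of `c` under the transition function `tr`. -/
def succ (tr : Q → Γ → Γ × HeadMove × Q) (c : ATM.Config Q Γ) : ATM.Config Q Γ :=
  ⟨(tr c.state (c.tape c.head)).2.2, c.head + (tr c.state (c.tape c.head)).2.1.shift,
    Function.update c.tape c.head (tr c.state (c.tape c.head)).1⟩

open Classical in
/-- The canonical encoding of `c`, whose head arrived by the movement `m`. -/
noncomputable def encoding (N : ℕ) (c : ATM.Config Q Γ) (m : HeadMove) (i : ℕ) :
    CellColour Q Γ :=
  if 0 < i ∧ i < N then
    if c.head = (i : ℤ) - 1 then head c.state (c.tape (i - 1)) m else sym (c.tape (i - 1))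
  else white

theorem encoding_ne_white {N : ℕ} {c : ATM.Config Q Γ} {m : HeadMove} {i : ℕ} (h0 : 0 < i)
    (hi : i < N) : encoding N c m i ≠ white := by
  rw [encoding, if_pos ⟨h0, hi⟩]
  split_ifs <;> simp

theorem encodes_encoding {N : ℕ} (hN : 2 ≤ N) (c : ATM.Config Q Γ) (m : HeadMove) :
    Encodes blank N (encoding N c m) c where
  left := by simp [encoding]
  right := by simp [encoding]
  first := encoding_ne_white one_pos hN
  cell i h0 hi := by
    by_cases h : c.head = (i : ℤ) - 1
    · exact Or.inl ⟨h, m, by simp [encoding, h0, hi, h]⟩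
    · exact Or.inr (Or.inl ⟨h, by simp [encoding, h0, hi, h]⟩)

theorem Encodes.congr {N : ℕ} {u v : ℕ → CellColour Q Γ} {c : ATM.Config Q Γ}
    (hu : Encodes blank N u c) (hN : 2 ≤ N) (h : ∀ i ≤ N, v i = u i) : Encodes blank N v c where
  left := by rw [h 0 (by omega), hu.left]
  right := by rw [h N le_rfl, hu.right]
  first := by rw [h 1 (by omega)]; exact hu.first
  cell i h0 hi := by
    rw [h i hi.le, h (i + 1) hi]
    exact hu.cell i h0 hi

section

variable {N : ℕ} {u : ℕ → CellColour Q Γ} {c : ATM.Config Q Γ}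

theorem Encodes.white_succ (hu : Encodes blank N u c) {i : ℕ} (h0 : 0 < i) (hi : i < N)
    (h : u i = white) : u (i + 1) = white := by
  rcases hu.cell i h0 hi with ⟨-, m, h'⟩ | ⟨-, h'⟩ | ⟨-, -, -, h'⟩
  · simp [h] at h'
  · simp [h] at h'
  · exact h'

theorem Encodes.symbol_eq (hu : Encodes blank N u c) {i : ℕ} (h0 : 0 < i) (hi : i < N) :
    (u i).symbol blank = c.tape (i - 1) := by
  rcases hu.cell i h0 hi with ⟨-, m, h⟩ | ⟨-, h⟩ | ⟨-, h, h', -⟩ <;> simp [symbol, *]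

/-- `InRange` keeps the head away from the corners `0` and `N`, which are white and stand for no
cell. -/
theorem Encodes.eq_head_iff (hu : Encodes blank N u c) (hc : InRange N c) {i : ℕ} (hi : i ≤ N)
    (p : Q) (a : Γ) : (∃ d, u i = head p a d) ↔
      c.head = (i : ℤ) - 1 ∧ p = c.state ∧ a = c.tape c.head := by
  have h1 := hc.1
  have h2 := hc.2
  rcases Nat.eq_zero_or_pos i with rfl | h0
  · simp only [hu.left, reduceCtorEq, exists_false, false_iff]
    rintro ⟨h, -⟩
    simp at h
    omega
  rcases hi.eq_or_lt with rfl | hi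
  · simp only [hu.right, reduceCtorEq, exists_false, false_iff]
    rintro ⟨h, -⟩
    omega
  rcases hu.cell i h0 hi with ⟨h, m, h'⟩ | ⟨h, h'⟩ | ⟨h, h', -, -⟩
  · simp only [h', h, head.injEq, true_and]
    constructor
    · rintro ⟨d, rfl, rfl, -⟩
      exact ⟨rfl, rfl⟩
    · rintro ⟨rfl, rfl⟩
      exact ⟨m, rfl, rfl, rfl⟩
  · simp [h', h]
  · simp [h', h]

theorem Encodes.sends_iff (hu : Encodes blank N u c) (hc : InRange N c) {i : ℕ} (hi : i ≤ N)
    (m : HeadMove) (q : Q) : (u i).Sends tr m q ↔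
      c.head = (i : ℤ) - 1 ∧ (tr c.state (c.tape c.head)).2 = (m, q) := by
  constructor
  · rintro ⟨p, a, d, h, h'⟩
    obtain ⟨hh, rfl, rfl⟩ := (hu.eq_head_iff hc hi p a).1 ⟨d, h⟩
    exact ⟨hh, h'⟩
  · rintro ⟨h, h'⟩
    obtain ⟨d, hd⟩ := (hu.eq_head_iff hc hi _ _).2 ⟨h, rfl, rfl⟩
    exact ⟨_, _, d, hd, h'⟩

theorem Encodes.scanned_iff (hu : Encodes blank N u c) (hc : InRange N c) {i : ℕ} (hi : i ≤ N)
    (p : Q → Prop) : (u i).Scanned p ↔ c.head = (i : ℤ) - 1 ∧ p c.state := by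
  constructor
  · rintro ⟨q, a, d, h, h'⟩
    obtain ⟨hh, rfl, rfl⟩ := (hu.eq_head_iff hc hi q a).1 ⟨d, h⟩
    exact ⟨hh, h'⟩
  · rintro ⟨h, h'⟩
    obtain ⟨d, hd⟩ := (hu.eq_head_iff hc hi _ _).2 ⟨h, rfl, rfl⟩
    exact ⟨_, _, d, hd, h'⟩

theorem Encodes.next_eq (hu : Encodes blank N u c) {i : ℕ} (h0 : 0 < i) (hi : i < N) {b : Γ}
    {m : HeadMove} {q : Q} (htr : tr c.state (c.tape c.head) = (b, m, q)) :
    (c.head = (i : ℤ) - 1 ∧ m = .N ∧ (u i).next blank tr = head q b .N) ∨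
    (c.head = (i : ℤ) - 1 ∧ m ≠ .N ∧ (u i).next blank tr = sym b) ∨
    (c.head ≠ (i : ℤ) - 1 ∧ (u i).next blank tr = sym (c.tape (i - 1))) := by
  rcases hu.cell i h0 hi with ⟨h, d, h'⟩ | ⟨h, h'⟩ | ⟨h, h', h'', -⟩
  · rw [h] at htr
    rw [h', next, htr]
    rcases m with _ | _ | _ <;> simp [h]
  · simp [h, h', next]
  · simp [h, h', h'', next]

/-- There is only one head, so at most one neighbour sends it here. The three cases are arrival from
the left, arrival from the right and neither; a head that does not move belongs to the last case. -/
theorem Encodes.encoding_succ (hu : Encodes blank N u c) (hc : InRange N c) {i : ℕ} (h0 : 0 < i)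
    (hi : i < N) :
    (∃ q, (u (i - 1)).Sends tr .R q ∧ (¬ ∃ q, (u (i + 1)).Sends tr .L q) ∧
      encoding N (succ tr c) (tr c.state (c.tape c.head)).2.1 i =
        head q ((u i).symbol blank) .R) ∨
    (∃ q, (u (i + 1)).Sends tr .L q ∧ (¬ ∃ q, (u (i - 1)).Sends tr .R q) ∧
      encoding N (succ tr c) (tr c.state (c.tape c.head)).2.1 i =
        head q ((u i).symbol blank) .L) ∨
    ((¬ ∃ q, (u (i + 1)).Sends tr .L q) ∧ (¬ ∃ q, (u (i - 1)).Sends tr .R q) ∧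
      encoding N (succ tr c) (tr c.state (c.tape c.head)).2.1 i = (u i).next blank tr) := by
  simp only [hu.sends_iff hc (show i - 1 ≤ N by omega), hu.sends_iff hc (show i + 1 ≤ N by omega)]
  have hs := hu.symbol_eq h0 hi
  obtain ⟨⟨b, m, q⟩, htr⟩ : ∃ t, tr c.state (c.tape c.head) = t := ⟨_, rfl⟩
  have hn := hu.next_eq h0 hi htr
  simp only [encoding, h0, hi, and_self, if_true, hs, succ, htr]
  have e1 : ((i - 1 : ℕ) : ℤ) = i - 1 := by omega
  rw [e1]
  push_cast
  have sL : HeadMove.L.shift = -1 := rfl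
  have sN : HeadMove.N.shift = 0 := rfl
  have sR : HeadMove.R.shift = 1 := rfl
  rcases m with _ | _ | _ <;> simp only [Prod.mk.injEq, reduceCtorEq, true_and] at hn ⊢
  · by_cases h : c.head = i
    · refine Or.inr (Or.inl ⟨q, ⟨by omega, rfl⟩, by simp, ?_⟩)
      rw [if_pos (by omega), Function.update_of_ne (by omega)]
    · refine Or.inr (Or.inr ⟨by rintro ⟨q, h', -⟩; omega, by simp, ?_⟩)
      rw [if_neg (by omega)]
      rcases hn with ⟨_, h', _⟩ | ⟨h', -, h''⟩ | ⟨h', h''⟩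
      · exact h'.elim
      · rw [h'', h', Function.update_self]
      · rw [h'', Function.update_of_ne (Ne.symm h')]
  · refine Or.inr (Or.inr ⟨by simp, by simp, ?_⟩)
    rcases hn with ⟨h', h''⟩ | ⟨h', h, h''⟩ | ⟨h', h''⟩
    · rw [if_pos (by omega), h'', h', Function.update_self]
    · exact absurd rfl h
    · rw [if_neg (by omega), h'', Function.update_of_ne (Ne.symm h')]
  · by_cases h : c.head = i - 1 - 1
    · refine Or.inl ⟨q, ⟨h, rfl⟩, by simp, ?_⟩
      rw [if_pos (by omega), Function.update_of_ne (by omega)]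
    · refine Or.inr (Or.inr ⟨by simp, by rintro ⟨q, h', -⟩; omega, ?_⟩)
      rw [if_neg (by omega)]
      rcases hn with ⟨_, h', _⟩ | ⟨h', -, h''⟩ | ⟨h', h''⟩
      · exact h'.elim
      · rw [h'', h', Function.update_self]
      · rw [h'', Function.update_of_ne (Ne.symm h')]

/-- Both neighbours together determine the next colour of a cell. -/
theorem Encodes.rightOK_and_leftOK_iff (hu : Encodes blank N u c) (hc : InRange N c) {i : ℕ}
    (h0 : 0 < i) (hi : i < N) (x : CellColour Q Γ) :
    (RightOK blank tr (u (i - 1)) (u i) x ∧ LeftOK blank tr (u i) (u (i + 1)) x) ↔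
      x = encoding N (succ tr c) (tr c.state (c.tape c.head)).2.1 i := by
  -- In `LeftOK`, white may stay only next to a colour other than white, but an inner white corner
  -- is followed by white.
  have hx : x = white → ¬ (RightOK blank tr (u (i - 1)) (u i) x ∧
      LeftOK blank tr (u i) (u (i + 1)) x) := by
    rintro rfl ⟨-, hl⟩
    exact hl.white.2 (hu.white_succ h0 hi hl.white.1)
  have key := hu.encoding_succ (tr := tr) hc h0 hi
  constructor
  · intro h
    have hw : x ≠ white := fun hw => hx hw h
    obtain ⟨hr, hl⟩ := h
    replace hr := hr.resolve_left fun h => hw h.2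
    replace hl := hl.resolve_left fun h => hw h.2.2
    rcases key with ⟨q, hq, hn, he⟩ | ⟨q, hq, hn, he⟩ | ⟨hn, hn', he⟩
    · obtain ⟨q', hq', rfl⟩ := hr.resolve_right fun h => h.1 ⟨q, hq⟩
      have h1 := (hu.sends_iff hc (by omega) _ _).1 hq
      have h2 := (hu.sends_iff hc (by omega) _ _).1 hq'
      rw [he, (Prod.mk.inj (h1.2.symm.trans h2.2)).2]
    · obtain ⟨q', hq', rfl⟩ := hl.resolve_right fun h => h.1 ⟨q, hq⟩
      have h1 := (hu.sends_iff hc (by omega) _ _).1 hq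
      have h2 := (hu.sends_iff hc (by omega) _ _).1 hq'
      rw [he, (Prod.mk.inj (h1.2.symm.trans h2.2)).2]
    · rw [he]
      obtain ⟨-, hr⟩ := hr.resolve_left fun ⟨q, hq, _⟩ => hn' ⟨q, hq⟩
      obtain ⟨-, hl⟩ := hl.resolve_left fun ⟨q, hq, _⟩ => hn ⟨q, hq⟩
      rcases hr with hr | ⟨q, hr⟩
      · exact hr
      · rcases hl with hl | ⟨q', hl⟩
        · exact hl
        -- Both tiles guess an arrival from their unseen side; the recorded directions `.L` and `.R`
        -- contradict each other.
        · simp [hr] at hl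
  · rintro rfl
    rcases key with ⟨q, hq, hn, he⟩ | ⟨q, hq, hn, he⟩ | ⟨hn, hn', he⟩ <;> rw [he]
    · exact ⟨Or.inr (Or.inl ⟨q, hq, rfl⟩), Or.inr (Or.inr ⟨hn, Or.inr ⟨q, rfl⟩⟩)⟩
    · exact ⟨Or.inr (Or.inr ⟨hn, Or.inr ⟨q, rfl⟩⟩), Or.inr (Or.inl ⟨q, hq, rfl⟩)⟩
    · exact ⟨Or.inr (Or.inr ⟨hn', Or.inl rfl⟩), Or.inr (Or.inr ⟨hn, Or.inl rfl⟩)⟩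

theorem forall_lt_of_forall_succ_iff {A : ℕ → Prop} {p : ℕ} (hp : p < N) (hA : A p)
    (h : ∀ j, j + 1 < N → (A j ↔ A (j + 1))) : ∀ j < N, A j := by
  have h0 : ∀ j, j < N → (A j ↔ A 0) := by
    intro j
    induction j with
    | zero => simp
    | succ j ih => exact fun hj => (h j hj).symm.trans (ih (by omega))
  exact fun j hj => (h0 j hj).2 ((h0 p hp).1 hA)

/-- Tiles that simulate a step and tiles that erase do not occur in the same row. -/
theorem Encodes.isStepTile_succ_iff (hu : Encodes blank N u c) {acc : Q} {v : ℕ → CellColour Q Γ}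
    {j : ℕ} (hj : j + 1 < N)
    (h1 : IsStepTile blank tr acc (u j, u (j + 1), v j, v (j + 1)) ∨
      IsEraseTile acc (u j, u (j + 1), v j, v (j + 1)))
    (h2 : IsStepTile blank tr acc (u (j + 1), u (j + 2), v (j + 1), v (j + 2)) ∨
      IsEraseTile acc (u (j + 1), u (j + 2), v (j + 1), v (j + 2))) :
    (IsStepTile blank tr acc (u j, u (j + 1), v j, v (j + 1)) ↔
      IsStepTile blank tr acc (u (j + 1), u (j + 2), v (j + 1), v (j + 2))) ∧
    (IsEraseTile acc (u j, u (j + 1), v j, v (j + 1)) ↔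
      IsEraseTile acc (u (j + 1), u (j + 2), v (j + 1), v (j + 2))) := by
  -- The shared lower corner would be white, hence so would the corner above it and the next one to
  -- the right; an erasing tile forbids this pair.
  have hA : IsStepTile blank tr acc (u j, u (j + 1), v j, v (j + 1)) →
      ¬ IsEraseTile acc (u (j + 1), u (j + 2), v (j + 1), v (j + 2)) := by
    rintro ⟨-, -, -, h⟩ ⟨-, -, h', hw, -⟩
    simp only [Tile.upLeft, Tile.upRight, Tile.lowLeft, Tile.lowRight] at h h' hw
    rw [hw] at h
    exact h' ⟨h.white, hu.white_succ j.succ_pos hj h.white⟩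
  have hB : IsEraseTile acc (u j, u (j + 1), v j, v (j + 1)) →
      ¬ IsStepTile blank tr acc (u (j + 1), u (j + 2), v (j + 1), v (j + 2)) := by
    rintro ⟨-, -, -, -, hw⟩ ⟨-, -, h, -⟩
    simp only [Tile.upLeft, Tile.upRight, Tile.lowLeft, Tile.lowRight] at h hw
    rw [hw] at h
    exact h.white.2 (hu.white_succ j.succ_pos hj h.white.1)
  tauto

theorem InRange.exists_corner (hc : InRange N c) : ∃ p < N, 0 < p ∧ c.head = (p : ℤ) - 1 :=
  ⟨c.head.toNat + 1, by have := hc.1; have := hc.2; omega, by omega,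
    by have := hc.1; omega⟩

/-- Below a configuration whose state is not accepting, the successor configuration is forced. -/
theorem Encodes.step_forced (hu : Encodes blank N u c) (hc : InRange N c) {acc : Q}
    (hacc : c.state ≠ acc) {v : ℕ → CellColour Q Γ} (hv0 : v 0 = white) (hvN : v N = white) :
    (∀ j < N, IsStepTile blank tr acc (u j, u (j + 1), v j, v (j + 1)) ∨
      IsEraseTile acc (u j, u (j + 1), v j, v (j + 1))) ↔
    ∀ i ≤ N, v i = encoding N (succ tr c) (tr c.state (c.tape c.head)).2.1 i := by
  have hns : ∀ i ≤ N, ¬ (u i).Scanned (· = acc) := fun i hi h =>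
    hacc ((hu.scanned_iff hc hi _).1 h).2
  constructor
  · intro h
    obtain ⟨p, hpN, hp0, hp⟩ := hc.exists_corner
    -- The tile to the right of the scanned corner cannot erase, as the state is not accepting; its
    -- kind spreads over the whole row.
    have hall := forall_lt_of_forall_succ_iff
      (A := fun j => IsStepTile blank tr acc (u j, u (j + 1), v j, v (j + 1))) hpN
      ((h p hpN).resolve_right fun h => h.1 ((hu.scanned_iff hc hpN.le _).2 ⟨hp, hacc⟩))
      fun j hj => (hu.isStepTile_succ_iff hj (h j (by omega)) (h (j + 1) hj)).1
    intro i hi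
    rcases Nat.eq_zero_or_pos i with rfl | h0
    · simp [encoding, hv0]
    rcases hi.eq_or_lt with rfl | hi
    · simp [encoding, hvN]
    obtain ⟨k, rfl⟩ : ∃ k, i = k + 1 := ⟨i - 1, by omega⟩
    exact (hu.rightOK_and_leftOK_iff hc h0 hi _).1
      ⟨(hall k (by omega)).2.2.2, (hall (k + 1) hi).2.2.1⟩
  · intro h j hj
    refine Or.inl ⟨hns _ hj.le, hns _ hj, ?_, ?_⟩
    · rcases Nat.eq_zero_or_pos j with rfl | h0
      · exact Or.inl ⟨hu.left, hu.first, hv0⟩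
      · exact ((hu.rightOK_and_leftOK_iff hc h0 hj _).2 (h j hj.le)).2
    · rcases hj.nat_succ_le.eq_or_lt with rfl | hj
      · exact Or.inl ⟨hu.right, hvN⟩
      · exact ((hu.rightOK_and_leftOK_iff hc j.succ_pos hj _).2 (h (j + 1) hj.le)).1

/-- Below an accepting configuration, the white row is forced. -/
theorem Encodes.erase_forced (hu : Encodes blank N u c) (hc : InRange N c) {acc : Q}
    (hacc : c.state = acc) (hw : ∀ i, 0 < i → i < N → u i ≠ white) {v : ℕ → CellColour Q Γ} :
    (∀ j < N, IsStepTile blank tr acc (u j, u (j + 1), v j, v (j + 1)) ∨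
      IsEraseTile acc (u j, u (j + 1), v j, v (j + 1))) ↔ ∀ i ≤ N, v i = white := by
  obtain ⟨p, hpN, hp0, hp⟩ := hc.exists_corner
  constructor
  · intro h
    have hall := forall_lt_of_forall_succ_iff
      (A := fun j => IsEraseTile acc (u j, u (j + 1), v j, v (j + 1))) hpN
      ((h p hpN).resolve_left fun h => h.1 ((hu.scanned_iff hc hpN.le _).2 ⟨hp, hacc⟩))
      fun j hj => (hu.isStepTile_succ_iff hj (h j (by omega)) (h (j + 1) hj)).2
    intro i hi
    rcases hi.eq_or_lt with rfl | hi
    · obtain ⟨k, rfl⟩ : ∃ k, i = k + 1 := ⟨i - 1, by omega⟩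
      exact (hall k (by omega)).2.2.2.2
    · exact (hall i hi).2.2.2.1
  · intro h j hj
    have hns : ∀ i ≤ N, ¬ (u i).Scanned (· ≠ acc) := fun i hi h =>
      ((hu.scanned_iff hc hi _).1 h).2 hacc
    refine Or.inr ⟨hns _ hj.le, hns _ hj, ?_, h j hj.le, h (j + 1) hj⟩
    -- Two adjacent white upper corners would require an inner white corner, that is, padding, which
    -- `hw` and `hu.first` exclude.
    rintro ⟨h1, h2⟩
    simp only [Tile.upLeft, Tile.upRight] at h1 h2
    rcases Nat.eq_zero_or_pos j with rfl | h0
    · exact hu.first h2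
    · exact hw j h0 hj h1

theorem Encodes.exists_ne_white (hu : Encodes blank N u c) (hc : InRange N c) :
    ∃ i < N, u i ≠ white := by
  obtain ⟨p, hpN, hp0, hp⟩ := hc.exists_corner
  obtain ⟨q, a, m, h, -⟩ := (hu.scanned_iff hc hpN.le fun _ => True).2 ⟨hp, trivial⟩
  exact ⟨p, hpN, by simp [h]⟩

end

end CellColour

/-! ### Plays simulate computations -/

open CellColour TilingGame

namespace ATM

variable {Q Γ : Type} {M : ATM Q Γ}

/-- The two transitions for each state and symbol as two transition functions, which stay put in
final states. -/
structure IsTransition (M : ATM Q Γ) (tr : Bool → Q → Γ → Γ × HeadMove × Q) : Prop where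
  mem_iff : ∀ q a, ¬ M.IsFinal q → ∀ t, (q, a, t) ∈ M.δ ↔ ∃ b, t = tr b q a
  final : ∀ b q a, M.IsFinal q → tr b q a = (a, .N, q)

theorem exists_isTransition (M : ATM Q Γ) : ∃ tr, IsTransition M tr := by
  classical
  have h : ∀ q a, ∃ s : Bool → Γ × HeadMove × Q,
      ¬ M.IsFinal q → ∀ t, (q, a, t) ∈ M.δ ↔ ∃ b, t = s b := by
    intro q a
    by_cases hq : M.IsFinal q
    · exact ⟨fun _ => (a, .N, q), fun h => absurd hq h⟩
    · obtain ⟨x, y, -, hxy⟩ := Set.ncard_eq_two.1 (M.two_transitions q a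
        (fun h => hq (Or.inl h)) fun h => hq (Or.inr h))
      refine ⟨fun b => if b then x else y, fun _ t => ?_⟩
      have := Set.ext_iff.1 hxy t
      simp only [Set.mem_ofPred_eq, Set.mem_insert_iff, Set.mem_singleton_iff] at this
      simp [this, or_comm]
  choose s hs using h
  refine ⟨fun b q a => if M.IsFinal q then (a, .N, q) else s q a b, fun q a hq t => ?_,
    fun b q a hq => by simp [hq]⟩
  simp [hq, hs q a hq t]

variable {tr : Bool → Q → Γ → Γ × HeadMove × Q}

theorem IsTransition.step_iff (htr : IsTransition M tr) {c c' : Config Q Γ}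
    (hc : ¬ M.IsFinal c.state) : M.Step c c' ↔ ∃ b, c' = succ (tr b) c := by
  constructor
  · rintro ⟨-, b, m, q, h, rfl⟩
    obtain ⟨i, hi⟩ := (htr.mem_iff _ _ hc _).1 h
    exact ⟨i, by simp [succ, ← hi]⟩
  · rintro ⟨b, rfl⟩
    exact ⟨hc, _, _, _, (htr.mem_iff _ _ hc _).2 ⟨b, rfl⟩, rfl⟩

/-- A rejecting configuration is thus copied from row to row: moves remain possible and unique, but
no corridor ever arises. -/
theorem IsTransition.succ_eq_self (htr : IsTransition M tr) {c : Config Q Γ}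
    (hc : M.IsFinal c.state) (b : Bool) : succ (tr b) c = c := by
  simp [succ, htr.final b _ _ hc, HeadMove.shift]

open Classical in
/-- The tile system that simulates `M`. -/
noncomputable def tileSystem [Fintype Q] [Fintype Γ] (M : ATM Q Γ)
    (tr : Bool → Q → Γ → Γ × HeadMove × Q) : TileSystem (CellColour Q Γ) where
  T b := Finset.univ.filter fun t => IsStepTile M.blank (tr b) M.acc t ∨ IsEraseTile M.acc t
  white := white
  L := Finset.univ.filter fun t => IsEraseTile M.acc t
  L_subset t ht := Or.inl (by simp at ht; simp [ht])

/-- `G` is played with the tiles that simulate `M`, and its rows are wide enough for all computations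
on `w`. -/
structure IsSimulatedBy (M : ATM Q Γ) (tr : Bool → Q → Γ → Γ × HeadMove × Q) (w : List Γ)
    (G : TilingGame (CellColour Q Γ)) : Prop where
  mem_T : ∀ b t, t ∈ G.T b ↔ IsStepTile M.blank (tr b) M.acc t ∨ IsEraseTile M.acc t
  mem_L : ∀ t, t ∈ G.L ↔ IsEraseTile M.acc t
  white_eq : G.white = white
  inRange : ∀ c, Relation.ReflTransGen M.Step (M.initial w) c → InRange (2 ^ G.n) c

/-- The last of the rows `R` encodes the configuration `c` of a computation on `w`. -/
structure Represents (M : ATM Q Γ) (w : List Γ) (G : TilingGame (CellColour Q Γ))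
    (R : List G.Row) (c : Config Q Γ) : Prop where
  correct : G.TilingCorrect R
  edge : ∃ r, R.getLast? = some r ∧ Encodes M.blank (2 ^ G.n) (G.lowerEdge r) c ∧
    -- Erasing needs a row without padding. Every row after the first has none, and the first will
    -- not be accepting.
    (c.state = M.acc → ∀ i, 0 < i → i < 2 ^ G.n → G.lowerEdge r i ≠ white)
  reach : Relation.ReflTransGen M.Step (M.initial w) c
  -- In a final state the configuration stands still while the turns still alternate, so nothing can
  -- be required there.
  turn : M.IsFinal c.state ∨ (G.ProverTurn R ↔ c.state ∈ M.E)

section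

variable {w : List Γ} {G : TilingGame (CellColour Q Γ)} {R : List G.Row} {c : Config Q Γ}

theorem Represents.not_isCorridor (hR : Represents M w G R c) (hG : IsSimulatedBy M tr w G) :
    ¬ G.IsCorridor R := by
  rintro ⟨-, h⟩
  obtain ⟨r, hr, he, -⟩ := hR.edge
  obtain ⟨i, hi, hw⟩ := he.exists_ne_white (hG.inRange c hR.reach)
  have := (h r hr ⟨i, hi⟩).2.1
  rw [← lowerEdge_coe, hG.white_eq] at this
  exact hw this

/-- From rows that represent a configuration, exactly one move is possible with each set. -/
theorem Represents.existsUnique_move (hR : Represents M w G R c) (hG : IsSimulatedBy M tr w G)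
    (b : Bool) : (∃! r, G.Move R b r) ∧ ∀ r, G.Move R b r →
      (c.state = M.acc → ∀ i ≤ 2 ^ G.n, G.lowerEdge r i = white) ∧
      (c.state ≠ M.acc → ∃ m, ∀ i ≤ 2 ^ G.n,
        G.lowerEdge r i = encoding (2 ^ G.n) (succ (tr b) c) m i) := by
  obtain ⟨r₀, hr₀, he, hacc⟩ := hR.edge
  have hc := hG.inRange c hR.reach
  have hmain : ∀ e : ℕ → CellColour Q Γ, e 0 = white → e (2 ^ G.n) = white →
      (∀ v : ℕ → CellColour Q Γ, v 0 = white → v (2 ^ G.n) = white →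
        ((∀ j < 2 ^ G.n, IsStepTile M.blank (tr b) M.acc
            (G.lowerEdge r₀ j, G.lowerEdge r₀ (j + 1), v j, v (j + 1)) ∨
          IsEraseTile M.acc (G.lowerEdge r₀ j, G.lowerEdge r₀ (j + 1), v j, v (j + 1))) ↔
        ∀ i ≤ 2 ^ G.n, v i = e i)) →
      (∃! r, G.Move R b r) ∧ ∀ r, G.Move R b r → ∀ i ≤ 2 ^ G.n, G.lowerEdge r i = e i := by
    intro e h0 hN he
    rw [← hG.white_eq] at h0 hN
    have key := move_iff_of_forced hR.correct hr₀ (b := b) h0 hN (by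
      simpa only [hG.mem_T, hG.white_eq] using he)
    exact ⟨⟨_, (key _).2 fun _ => rfl, fun r hr => funext ((key r).1 hr)⟩, fun r hr i hi =>
      lowerEdge_of_forall (x := G.lowerEdge r₀) (y := fun i => G.lowerEdge r₀ (i + 1)) hN
        ((key r).1 hr) hi⟩
  by_cases hs : c.state = M.acc
  · obtain ⟨h1, h2⟩ := hmain (fun _ => white) rfl rfl fun v _ _ => he.erase_forced hc hs (hacc hs)
    exact ⟨h1, fun r hr => ⟨fun _ => h2 r hr, fun h => absurd hs h⟩⟩
  · obtain ⟨h1, h2⟩ := hmain _ (by simp [encoding]) (by simp [encoding])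
      fun v h0 hN => he.step_forced hc hs h0 hN
    exact ⟨h1, fun r hr => ⟨fun h => absurd h hs, fun _ => ⟨_, h2 r hr⟩⟩⟩

/-- After an accepting configuration, the corridor is completed. -/
theorem Represents.isCorridor_append (hR : Represents M w G R c) (hG : IsSimulatedBy M tr w G)
    (hc : c.state = M.acc) {b : Bool} {r : G.Row} (hr : G.Move R b r) :
    G.IsCorridor (R ++ [r]) := by
  refine ⟨hr.2, fun r' hr' j => ?_⟩
  obtain rfl : r = r' := by simpa using hr'
  have hw := ((hR.existsUnique_move hG b).2 r hr).1 hc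
  have hrc : G.RowCorrect r := hr.2.2.2.1 r (by simp)
  have h1 : (r j).lowLeft = white := by rw [← lowerEdge_coe]; exact hw _ j.2.le
  have h2 : (r j).lowRight = white := by rw [← hrc.lowerEdge_succ]; exact hw _ j.2
  refine ⟨(hG.mem_L _).2 (((hG.mem_T b _).1 (hr.1 j)).resolve_left ?_), ?_, ?_⟩
  -- A step tile with two white lower corners would need its upper right corner to be white and not
  -- white.
  · rintro ⟨-, -, hl, hr⟩
    rw [h1] at hl
    rw [h2] at hr
    exact hl.white.2 hr.white
  · rw [h1, hG.white_eq]
  · rw [h2, hG.white_eq]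

theorem Represents.append (hR : Represents M w G R c) (hG : IsSimulatedBy M tr w G)
    (htr : IsTransition M tr) (hc : c.state ≠ M.acc) {b : Bool} {r : G.Row}
    (hr : G.Move R b r) : Represents M w G (R ++ [r]) (succ (tr b) c) := by
  obtain ⟨m, hm⟩ := ((hR.existsUnique_move hG b).2 r hr).2 hc
  have hN : 2 ≤ 2 ^ G.n := by
    have := hG.inRange c hR.reach
    have h1 := this.1
    have h2 := this.2
    zify
    push_cast at h2
    omega
  have hedge : ∃ r', (R ++ [r]).getLast? = some r' ∧
      Encodes M.blank (2 ^ G.n) (G.lowerEdge r') (succ (tr b) c) ∧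
      ((succ (tr b) c).state = M.acc → ∀ i, 0 < i → i < 2 ^ G.n →
        G.lowerEdge r' i ≠ white) :=
    ⟨r, by simp, (encodes_encoding hN _ m).congr hN hm, fun _ i h0 hi => by
      rw [hm i hi.le]
      exact encoding_ne_white h0 hi⟩
  by_cases hf : M.IsFinal c.state
  · rw [htr.succ_eq_self hf] at hedge ⊢
    exact ⟨hr.2, hedge, hR.reach, Or.inl hf⟩
  · have hs : M.Step c (succ (tr b) c) := (htr.step_iff hf).2 ⟨b, rfl⟩
    refine ⟨hr.2, hedge, hR.reach.tail hs, Or.inr ?_⟩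
    have hE := M.alternating _ _ _ _ _ ((htr.mem_iff c.state (c.tape c.head) hf _).2 ⟨b, rfl⟩)
    have ht := hR.turn.resolve_left hf
    have hlen : G.ProverTurn (R ++ [r]) ↔ ¬ G.ProverTurn R := by
      simp only [ProverTurn, List.length_append, List.length_singleton]
      exact Nat.odd_add_one
    rw [hlen, ht, hE, not_not]
    rfl

theorem represents_or_isCorridor (hG : IsSimulatedBy M tr w G) (htr : IsTransition M tr)
    (h0 : Represents M w G [G.firstRow] (M.initial w))
    (hR : Relation.ReflTransGen G.Step [G.firstRow] R) :
    (∃ c, Represents M w G R c) ∨ G.IsCorridor R := by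
  induction hR with
  | refl => exact Or.inl ⟨_, h0⟩
  | tail _ hs ih =>
    obtain ⟨hcor, b, r, hmove, rfl⟩ := hs
    obtain ⟨c, hc⟩ := ih.resolve_right hcor
    by_cases hacc : c.state = M.acc
    · exact Or.inr (hc.isCorridor_append hG hacc hmove)
    · exact Or.inl ⟨_, hc.append hG htr hacc hmove⟩

theorem IsSimulatedBy.wellFormed (hG : IsSimulatedBy M tr w G) (htr : IsTransition M tr)
    (h0 : Represents M w G [G.firstRow] (M.initial w)) : G.WellFormed := by
  intro R hR hcor b
  obtain ⟨c, hc⟩ := (represents_or_isCorridor hG htr h0 hR).resolve_right hcor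
  exact (hc.existsUnique_move hG b).1

theorem LeadsToAcceptance.exists_winsWithin (hG : IsSimulatedBy M tr w G)
    (htr : IsTransition M tr) (hc : M.LeadsToAcceptance c) :
    ∀ R, Represents M w G R c → ∃ k, G.WinsWithin k R := by
  induction hc with
  | accepting c hacc =>
    intro R hR
    have hmove := fun b => (hR.existsUnique_move hG b).1.exists
    refine ⟨1, Or.inr ?_⟩
    by_cases ht : G.ProverTurn R
    · obtain ⟨r, hr⟩ := hmove false
      exact Or.inl ⟨ht, (false, r), hr, hR.isCorridor_append hG hacc hr⟩
    · exact Or.inr ⟨ht, ⟨false, hmove false⟩, fun b r hr => hR.isCorridor_append hG hacc hr⟩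
  | existential c c' hf hE hs _ ih =>
    intro R hR
    obtain ⟨b, rfl⟩ := (htr.step_iff hf).1 hs
    obtain ⟨r, hr⟩ := (hR.existsUnique_move hG b).1.exists
    obtain ⟨k, hk⟩ := ih _ (hR.append hG htr (fun h => hf (Or.inl h)) hr)
    exact ⟨k + 1, Or.inr (Or.inl ⟨(hR.turn.resolve_left hf).2 hE, (b, r), hr, hk⟩)⟩
  | universal c hf hE _ ih =>
    intro R hR
    have hmove := fun b => (hR.existsUnique_move hG b).1
    have hk : ∀ b, ∃ k, ∀ r, G.Move R b r → G.WinsWithin k (R ++ [r]) := by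
      intro b
      obtain ⟨r, hr, huniq⟩ := hmove b
      obtain ⟨k, hk⟩ := ih _ ((htr.step_iff hf).2 ⟨b, rfl⟩) _
        (hR.append hG htr (fun h => hf (Or.inl h)) hr)
      exact ⟨k, fun r' hr' => huniq r' hr' ▸ hk⟩
    choose k hk using hk
    -- Spoiler has only two moves, so the bounds for them have a maximum.
    refine ⟨max (k false) (k true) + 1, Or.inr (Or.inr
      ⟨fun ht => hE ((hR.turn.resolve_left hf).1 ht), ⟨false, (hmove false).exists⟩,
        fun b r hr => (hk b r hr).mono ?_⟩)⟩
    cases b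
    · exact le_max_left _ _
    · exact le_max_right _ _

/-- The induction runs along the plays that follow `σ`, as computations of `M` alone need not
terminate. -/
theorem IsSimulatedBy.leadsToAcceptance_of_isWinning (hG : IsSimulatedBy M tr w G)
    (htr : IsTransition M tr) {σ : G.Strategy} (hσ : G.IsWinning σ)
    (h0 : Represents M w G [G.firstRow] (M.initial w)) : M.Accepts w := by
  suffices h : ∀ R, Acc (fun R' R => G.StepFollowing σ R R') R →
      Relation.ReflTransGen (G.StepFollowing σ) [G.firstRow] R →
      ∀ c, Represents M w G R c → M.LeadsToAcceptance c from h _ hσ.acc .refl _ h0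
  intro R hacc
  induction hacc with
  | intro R _ ih =>
    intro hreach c hR
    by_cases hc : c.state = M.acc
    · exact .accepting c hc
    have hcor := hR.not_isCorridor hG
    have hnext : ∃ b, M.LeadsToAcceptance (succ (tr b) c) := by
      obtain ⟨R', hs⟩ := hσ.1 R hreach hcor
      obtain ⟨b, r, hmove, rfl⟩ := hs.1.2
      exact ⟨b, ih _ hs (hreach.tail hs) _ (hR.append hG htr hc hmove)⟩
    -- If `c` is rejecting, the longer play represents `c` again, and the induction hypothesis
    -- already speaks of `c` itself.
    by_cases hf : M.IsFinal c.state
    · obtain ⟨b, hb⟩ := hnext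
      rwa [htr.succ_eq_self hf] at hb
    by_cases hE : c.state ∈ M.E
    · obtain ⟨b, hb⟩ := hnext
      exact .existential c _ hf hE ((htr.step_iff hf).2 ⟨b, rfl⟩) hb
    · refine .universal c hf hE fun c' hs => ?_
      obtain ⟨b, rfl⟩ := (htr.step_iff hf).1 hs
      obtain ⟨r, hr⟩ := (hR.existsUnique_move hG b).1.exists
      -- It is Spoiler's turn, so `σ` does not constrain the move and both successors occur in plays
      -- that follow it.
      have hsf : G.StepFollowing σ R (R ++ [r]) :=
        ⟨⟨hcor, b, r, hr, rfl⟩, fun ht => absurd ((hR.turn.resolve_left hf).1 ht) hE⟩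
      exact ih _ hsf (hreach.tail hsf) _ (hR.append hG htr hc hr)

theorem IsSimulatedBy.proverWins_iff (hG : IsSimulatedBy M tr w G) (htr : IsTransition M tr)
    (h0 : Represents M w G [G.firstRow] (M.initial w)) : G.ProverWins ↔ M.Accepts w :=
  ⟨fun ⟨_, hσ⟩ => hG.leadsToAcceptance_of_isWinning htr hσ h0, fun h =>
    let ⟨_, hk⟩ := LeadsToAcceptance.exists_winsWithin hG htr h _ h0
    proverWins_of_winsWithin hk⟩

end

end ATM

theorem length_encodeWord {Γ C : Type} (f g : Γ → C) (w : List Γ) :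
    (encodeWord f g w).length = w.length := by
  cases w <;> simp [encodeWord]

/-! ### The first row and the initial configuration -/

section FirstRow

variable {C : Type} {S : TileSystem C} {u : List C}

theorem TileSystem.firstRow_apply (j : Fin (2 ^ (S.game u).n)) :
    (S.game u).firstRow j = (S.white, S.white, (S.white :: u).getD j S.white,
      (S.white :: u).getD (j + 1) S.white) := by
  unfold TilingGame.firstRow
  split_ifs with h
  · simp [TileSystem.game]
  · have h' : u.length + 1 ≤ j := not_lt.1 h
    rw [List.getD_eq_default _ _ (by simpa using h'),
      List.getD_eq_default _ _ (by simp; omega)]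
    rfl

/-- Since `n < 2 ^ n`, the initial word ends before the right edge. -/
theorem TileSystem.getD_two_pow :
    (S.white :: u).getD (2 ^ (S.game u).n) S.white = S.white :=
  List.getD_eq_default _ _ (Nat.lt_two_pow_self (n := u.length))

theorem TileSystem.lowerEdge_firstRow {i : ℕ} (hi : i ≤ 2 ^ (S.game u).n) :
    (S.game u).lowerEdge (S.game u).firstRow i = (S.white :: u).getD i S.white :=
  lowerEdge_of_forall (x := fun _ => S.white) (y := fun _ => S.white)
    (e := fun i => (S.white :: u).getD i S.white) getD_two_pow firstRow_apply hi

theorem TileSystem.tilingCorrect_firstRow :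
    (S.game u).TilingCorrect [(S.game u).firstRow] := by
  refine ⟨rfl, fun j => ?_, fun r hr => ?_, by simp⟩
  · rw [firstRow_apply]
    exact ⟨rfl, rfl⟩
  · obtain rfl : r = (S.game u).firstRow := by simpa using hr
    refine ⟨fun i j hij => ?_, fun j hj => ?_, fun j hj => ?_⟩
    · rw [firstRow_apply, firstRow_apply, hij]
      exact ⟨rfl, rfl⟩
    · rw [firstRow_apply, hj]
      exact ⟨rfl, rfl⟩
    · rw [firstRow_apply, hj]
      exact ⟨rfl, getD_two_pow⟩

end FirstRow

namespace ATM

variable {Q Γ : Type} [Fintype Q] [Fintype Γ] {M : ATM Q Γ}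
  {tr : Bool → Q → Γ → Γ × HeadMove × Q}

theorem represents_initial (hstart : M.start ≠ M.acc) {w : List Γ} (hw : w ≠ []) :
    Represents M w ((tileSystem M tr).game (encodeWord (head M.start · .N) sym w))
      [TilingGame.firstRow _] (M.initial w) := by
  obtain ⟨a, v, rfl⟩ := List.exists_cons_of_ne_nil hw
  set G := (tileSystem M tr).game (encodeWord (head M.start · .N) sym (a :: v))
  have hedge : ∀ i ≤ 2 ^ G.n, G.lowerEdge G.firstRow i =
      (white :: head M.start a .N :: v.map sym).getD i white :=
    fun i hi => TileSystem.lowerEdge_firstRow hi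
  have hN : 1 ≤ 2 ^ G.n := Nat.one_le_two_pow
  refine ⟨TileSystem.tilingCorrect_firstRow, ⟨G.firstRow, rfl, ⟨?_, lowerEdge_last _, ?_, ?_⟩,
    fun h => absurd h hstart⟩, .refl, Or.inr ?_⟩
  · rw [hedge 0 (Nat.zero_le _)]
    rfl
  · rw [hedge 1 hN]
    simp
  · intro i h0 hi
    rw [hedge i hi.le, hedge (i + 1) hi]
    rcases i with _ | _ | k
    · exact absurd h0 (lt_irrefl 0)
    -- The direction `.N` is arbitrary, since `Encodes` admits any direction of arrival.
    · exact Or.inl ⟨by simp [initial], .N, by simp [initial]⟩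
    · have e : ((k + 1 + 1 : ℕ) : ℤ) - 1 = (k + 1 : ℕ) := by push_cast; ring
      rw [e]
      have hh : (M.initial (a :: v)).head ≠ ((k + 1 : ℕ) : ℤ) := by
        simp only [initial]
        omega
      have ht : (M.initial (a :: v)).tape ((k + 1 : ℕ) : ℤ) = v.getD k M.blank := by
        simp only [initial, Int.toNat_natCast, List.getD_cons_succ]
        exact if_pos (by omega)
      refine Or.inr ?_
      rw [ht]
      by_cases hk : k < v.length
      · exact Or.inl ⟨hh, by simp [hk]⟩
      -- Beyond the input word the corners are padding, which stands for blank cells.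
      · refine Or.inr ⟨hh, ?_, ?_, ?_⟩
        · exact List.getD_eq_default _ _ (by simp; omega)
        · exact List.getD_eq_default _ _ (by omega)
        · exact List.getD_eq_default _ _ (by simp; omega)
  · exact iff_of_true odd_one M.start_mem

end ATM

/-! ### Size bound, degenerate case and conclusion -/

theorem TilingGame.size_le {C : Type} [Fintype C] (G : TilingGame C) :
    G.size ≤ Fintype.card C + 3 * Fintype.card C ^ 4 + 2 * G.n + 1 := by
  have h : ∀ s : Finset (Tile C), s.card ≤ Fintype.card C ^ 4 := fun s => by
    refine s.card_le_univ.trans (le_of_eq ?_)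
    simp only [Tile, Fintype.card_prod]
    ring
  have h1 := h (G.T false)
  have h2 := h (G.T true)
  have h3 := h G.L
  unfold size
  omega

/-- White is the only colour, so that the first row is a correctly tiled corridor. -/
def TileSystem.trivial : TileSystem Unit where
  T _ := {((), (), (), ())}
  white := ()
  L := {((), (), (), ())}
  L_subset _ h := Or.inl h

theorem TileSystem.isCorridor_trivial (u : List Unit) :
    (TileSystem.trivial.game u).IsCorridor [(TileSystem.trivial.game u).firstRow] :=
  ⟨⟨rfl, fun _ => ⟨rfl, rfl⟩, fun _ _ => ⟨fun _ _ _ => ⟨rfl, rfl⟩, fun _ _ => ⟨rfl, rfl⟩,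
    fun _ _ => ⟨rfl, rfl⟩⟩, by simp⟩, fun _ _ _ => ⟨Finset.mem_singleton.2 rfl, rfl, rfl⟩⟩

theorem mainTheorem5 :
    ∃ P : Polynomial ℕ, ∀ (Q Γ : Type) [Fintype Q] [Fintype Γ] (M : ATM Q Γ),
      ∃ (C : Type) (_ : Fintype C) (S : TileSystem C) (f g : Γ → C),
        ∀ w : List Γ, (∀ a ∈ w, a ∈ M.inputAlphabet) →
          M.UsesOnlyCells w (2 ^ w.length - 1) →
            (S.game (encodeWord f g w)).WellFormed ∧
            (S.game (encodeWord f g w)).size ≤ P.eval (M.size + w.length) ∧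
            ((S.game (encodeWord f g w)).ProverWins ↔ M.Accepts w) := by
  -- `K` bounds the number of colours as in `card_le`; `3 * K ^ 4` accounts for `T₀`, `T₁` and `L`,
  -- and `2 * X + 1` for `n` and the `n + 1` initial tiles.
  let K : Polynomial ℕ := 1 + .X * (1 + 3 * .X)
  refine ⟨K + 3 * K ^ 4 + 2 * .X + 1, fun Q Γ _ _ M => ?_⟩
  have hsize : ∀ (C : Type) [Fintype C] (S : TileSystem C) (f g : Γ → C) (w : List Γ),
      Fintype.card C ≤ 1 + Fintype.card Γ * (1 + 3 * Fintype.card Q) →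
      (S.game (encodeWord f g w)).size ≤
        (K + 3 * K ^ 4 + 2 * Polynomial.X + 1).eval (M.size + w.length) := by
    intro C _ S f g w hC
    refine (TilingGame.size_le _).trans ?_
    have hn : (S.game (encodeWord f g w)).n = w.length := length_encodeWord f g w
    have hC' : Fintype.card C ≤ K.eval (M.size + w.length) := by
      refine hC.trans ?_
      simp only [K, ATM.size, Polynomial.eval_add, Polynomial.eval_mul, Polynomial.eval_one,
        Polynomial.eval_X, Polynomial.eval_ofNat]
      gcongr <;> omega
    rw [hn]
    simp only [Polynomial.eval_add, Polynomial.eval_mul, Polynomial.eval_one,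
      Polynomial.eval_pow, Polynomial.eval_X, Polynomial.eval_ofNat]
    gcongr
    omega
  -- If the start state accepts, the padded first row could not be erased in general. Prover must
  -- always win, so a game that is over at once serves.
  by_cases hstart : M.start = M.acc
  · refine ⟨Unit, inferInstance, .trivial, fun _ => (), fun _ => (), fun w _ _ => ?_⟩
    obtain ⟨h1, h2⟩ := wellFormed_and_proverWins_of_isCorridor
      (TileSystem.isCorridor_trivial (encodeWord (fun _ => ()) (fun _ => ()) w))
    exact ⟨h1, hsize _ _ _ _ w (by simp), fun _ => .accepting _ hstart, fun _ => h2⟩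
  · obtain ⟨tr, htr⟩ := M.exists_isTransition
    refine ⟨CellColour Q Γ, inferInstance, M.tileSystem tr, (head M.start · .N), sym,
      fun w _ hspace => ?_⟩
    have hw : w ≠ [] := by
      -- For the empty word the bound is `2 ^ 0 - 1 = 0` cells, but the head initially scans cell
      -- `0`.
      rintro rfl
      have := hspace _ .refl
      simp at this
      omega
    have h0 := ATM.represents_initial (tr := tr) hstart hw
    have hG : ATM.IsSimulatedBy M tr w
        ((M.tileSystem tr).game (encodeWord (head M.start · .N) sym w)) := by
      refine ⟨fun b t => ?_, fun t => ?_, rfl, fun c hc => ?_⟩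
      · simp [TileSystem.game, ATM.tileSystem]
      · simp [TileSystem.game, ATM.tileSystem]
      · have := hspace c hc
        have hn : ((M.tileSystem tr).game (encodeWord (head M.start · .N) sym w)).n = w.length :=
          length_encodeWord _ _ w
        rw [hn]
        have h1 : 1 ≤ 2 ^ w.length := Nat.one_le_two_pow
        refine ⟨this.1, ?_⟩
        have := this.2
        push_cast [h1] at this ⊢
        exact this
    exact ⟨hG.wellFormed htr h0, hsize _ _ _ _ w card_le, hG.proverWins_iff htr h0⟩
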